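/- For each $n$, let $A=A^{(n)}\in\{0,1\}^{n\times n}$ be the adjacency matrix of a random undirected network on $n$ nodes without self-loops: $A$ is symmetric, $A_{ii}=0$, and the entries $A_{ij}$, $1\le i<j\le n$, are mutually independent Bernoulli random variables with arbitrary, possibly unequal, means $p_{ij}=p^{(n)}_{ij}=\mathbb{E}\{A_{ij}\}$. Assume that $n\min_{1\le i\neq j\le n}p_{ij}(1-p_{ij})\to\infty$ as $n\to\infty$ (this holds in particular if the $p_{ij}$ are bounded away from $0$ and $1$ uniformly in $i\neq j$ and $n$). Let $\tilde A^*\in\mathbb{R}^{n\times n}$ be the oracle normalized adjacency matrix, \[ \tilde A^*_{ij}=\frac{A_{ij}-p_{ij}}{\sqrt{np_{ij}(1-p_{ij})}}\quad (i\neq j),\qquad \tilde A^*_{ii}=0 . \] Then, as $n\to\infty$, $\frac{1}{\sqrt6}\,\mathrm{tr}\big((\tilde A^*)^3\big)$ converges in distribution to $N(0,1)$. -/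

import Mathlib

open MeasureTheory ProbabilityTheory Filter

/-- `A` is the adjacency matrix of a random undirected network on `n` nodes without self-loops
whose edges `{i, j}`, `i < j`, are present independently of each other, with link
probabilities that may be different for different pairs. -/
structure IsRandomNetwork {Ω : Type*} [MeasurableSpace Ω] (μ : Measure Ω) {n : ℕ}
    (A : Ω → Matrix (Fin n) (Fin n) ℝ) : Prop where
  /-- each entry is a random variable -/
  measurable_entry : ∀ i j, Measurable (fun ω => A ω i j)
  /-- entries in `{0, 1}`, symmetric, zero diagonal -/
  isAdjMatrix : ∀ ω, (A ω).IsAdjMatrix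
  /-- the entries above the diagonal are mutually independent -/
  indep : iIndepFun (fun (e : {e : Fin n × Fin n // e.1 < e.2}) ω => A ω e.1.1 e.1.2) μ

/-- The link probability `p_ij = E[A_ij]`. -/
noncomputable def linkProb {Ω : Type*} [MeasurableSpace Ω] (μ : Measure Ω) {n : ℕ}
    (A : Ω → Matrix (Fin n) (Fin n) ℝ) (i j : Fin n) : ℝ :=
  ∫ ω, A ω i j ∂μ

/-- The oracle normalized adjacency matrix, with entries
`(A_ij - p_ij) / √(n p_ij (1 - p_ij))` off the diagonal and zeros on the diagonal. -/
noncomputable def oracleNormalized {Ω : Type*} [MeasurableSpace Ω] (μ : Measure Ω) {n : ℕ}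
    (A : Ω → Matrix (Fin n) (Fin n) ℝ) (ω : Ω) : Matrix (Fin n) (Fin n) ℝ :=
  Matrix.of fun i j =>
    if i = j then 0
    else (A ω i j - linkProb μ A i j) /
      Real.sqrt ((n : ℝ) * linkProb μ A i j * (1 - linkProb μ A i j))

set_option linter.unusedSectionVars false

/-! Let `X` be the normalized matrix, `v = 1/n` the variance of its entries, `D_ij` the `(i, j)`
entry of `X²`, `W = tr(X³)/√6` and `φ(t) = E exp(itW)`. The proof derives Stein's equation for the
characteristic function, `φ'(t) ≈ -t φ(t)`.

For `i ≠ j`, `D_ij` does not involve `X_ij`, and `tr(X³) = ∑_{i≠j} X_ij D_ij` is affine in `X_ij`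
with slope `6 D_ij` (`cubeTrace_eq_update_add`). Expand `exp(itW)` in `X_ij` around `0`: the mean
kills the leading term and the variance gives `E[X_ij D_ij exp(itW)] ≈ it √6 v E[D_ij² exp(itW)]`,
with an error controlled by `δ v E|D_ij|³` (`norm_integral_mul_exp_sub_le`). Summing over `i ≠ j`
yields `φ'(t) ≈ -t E[(v ∑ D_ij²) exp(itW)]`.

The random variance `v ∑ D_ij²` is close to `1` in `L¹` (`integral_abs_sum_pathSum_sq_sub_one_le`):
it splits into squared row sums, each row sum being near `1`, and a sum over four-cycles. The moment
bounds rest on orthogonality of monomials with different edge sets, together with `n v = 1`. The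
integrating factor `exp(t²/2)` then turns Stein's equation into `φ(t) ≈ exp(-t²/2)`.

The network enters only through its edge indicators, so expectations are computed on a finite cube,
where integrability is automatic. If `n p (1 - p) ≥ C`, the entries are bounded by `δ = 1/√C`, and
all errors vanish as `C` and `n` grow. -/

/-- A symmetric array `X` of independent centred random variables, indexed by unordered pairs of
vertices, vanishing on the diagonal, with common variance `v` off the diagonal and bounded
by `δ`. -/
structure IsWignerArray {V Ω : Type*} [MeasurableSpace Ω] (X : Sym2 V → Ω → ℝ) (μ : Measure Ω)
    (v δ : ℝ) : Prop where
  indep : iIndepFun X μ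
  diag : ∀ e, e.IsDiag → X e = 0
  mean : ∀ e, ¬ e.IsDiag → ∫ ω, X e ω ∂μ = 0
  var : ∀ e, ¬ e.IsDiag → ∫ ω, X e ω ^ 2 ∂μ = v
  bound : ∀ e ω, |X e ω| ≤ δ

namespace IsWignerArray

/-! ### Orthogonality of edge monomials -/

section Moments

variable {V Ω : Type*} [Fintype V] [DecidableEq V] [Finite Ω] [MeasurableSpace Ω]
  [MeasurableSingletonClass Ω] {μ : Measure Ω} [IsProbabilityMeasure μ]
  {X : Sym2 V → Ω → ℝ} {v δ : ℝ}

lemma integral_prod_comp (h : IsWignerArray X μ v δ) (g : Sym2 V → ℝ → ℝ)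
    (hg : ∀ e, Measurable (g e)) :
    ∫ ω, ∏ e, g e (X e ω) ∂μ = ∏ e, ∫ ω, g e (X e ω) ∂μ :=
  h.indep.integral_fun_prod_comp (fun _ => (Measurable.of_discrete).aemeasurable)
    (fun e => (hg e).aestronglyMeasurable)

lemma integral_prod_sq (h : IsWignerArray X μ v δ) {s : Finset (Sym2 V)}
    (hs : ∀ e ∈ s, ¬ e.IsDiag) :
    ∫ ω, (∏ e ∈ s, X e ω) ^ 2 ∂μ = v ^ s.card := by
  have h1 : ∀ ω, (∏ e ∈ s, X e ω) ^ 2 = ∏ e, (if e ∈ s then X e ω ^ 2 else 1) := by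
    intro ω
    rw [Finset.prod_ite_mem, Finset.univ_inter, Finset.prod_pow]
  simp_rw [h1]
  rw [h.integral_prod_comp (fun e x => if e ∈ s then x ^ 2 else 1)
    (fun e => by split_ifs <;> fun_prop)]
  have h2 : ∀ e, ∫ ω, (if e ∈ s then X e ω ^ 2 else 1) ∂μ = if e ∈ s then v else 1 := by
    intro e
    split_ifs with he
    · exact h.var e (hs e he)
    · simp
  simp_rw [h2]
  rw [Finset.prod_ite_mem, Finset.univ_inter, Finset.prod_const]

/-- An edge in the symmetric difference of `s` and `t` occurs exactly once in the product, and its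
centred factor integrates to zero. -/
lemma integral_prod_mul_prod_of_ne (h : IsWignerArray X μ v δ) {s t : Finset (Sym2 V)}
    (hs : ∀ e ∈ s, ¬ e.IsDiag) (ht : ∀ e ∈ t, ¬ e.IsDiag) (hst : s ≠ t) :
    ∫ ω, (∏ e ∈ s, X e ω) * ∏ e ∈ t, X e ω ∂μ = 0 := by
  have h1 : ∀ ω, (∏ e ∈ s, X e ω) * ∏ e ∈ t, X e ω
      = ∏ e, ((if e ∈ s then X e ω else 1) * (if e ∈ t then X e ω else 1)) := by
    intro ω
    rw [Finset.prod_mul_distrib, Finset.prod_ite_mem, Finset.univ_inter, Finset.prod_ite_mem,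
      Finset.univ_inter]
  simp_rw [h1]
  rw [h.integral_prod_comp (fun e x => (if e ∈ s then x else 1) * (if e ∈ t then x else 1))
    (fun e => by split_ifs <;> fun_prop)]
  obtain ⟨e, he⟩ : ∃ e, ¬ (e ∈ s ↔ e ∈ t) := by
    by_contra! hc
    exact hst (Finset.ext hc)
  apply Finset.prod_eq_zero (Finset.mem_univ e)
  by_cases h3 : e ∈ s
  · have h4 : e ∉ t := by tauto
    simpa [h3, h4] using h.mean e (hs e h3)
  · have h4 : e ∈ t := by tauto
    simpa [h3, h4] using h.mean e (ht e h4)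

/-- Parseval's identity for multilinear polynomials in the array. -/
lemma integral_sum_prod_sq (h : IsWignerArray X μ v δ) {ι : Type*} (I : Finset ι)
    (F : ι → Finset (Sym2 V)) (hF : ∀ c ∈ I, ∀ e ∈ F c, ¬ e.IsDiag)
    (hinj : Set.InjOn F I) :
    ∫ ω, (∑ c ∈ I, ∏ e ∈ F c, X e ω) ^ 2 ∂μ = ∑ c ∈ I, v ^ (F c).card := by
  simp_rw [sq, Finset.sum_mul_sum]
  rw [integral_finsetSum _ fun _ _ => .of_finite]
  refine Finset.sum_congr rfl fun c hc => ?_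
  rw [integral_finsetSum _ fun _ _ => .of_finite, Finset.sum_eq_single_of_mem c hc]
  · simp_rw [← sq]
    exact h.integral_prod_sq (hF c hc)
  · intro c' hc' hne
    exact h.integral_prod_mul_prod_of_ne (hF c hc) (hF c' hc')
      fun heq => hne (hinj hc' hc heq.symm)

end Moments

end IsWignerArray

/-! ### Squares of sums and four-cycles -/

lemma sq_sum_eq_sum_sq_add_two_mul {V : Type*} [Fintype V] [LinearOrder V] (a : V → ℝ) :
    (∑ k, a k) ^ 2 = ∑ k, a k ^ 2
      + 2 * ∑ p : V × V with p.1 < p.2, a p.1 * a p.2 := by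
  have h1 : (∑ k, a k) ^ 2 = ∑ p : V × V, a p.1 * a p.2 := by
    rw [sq, Finset.sum_mul_sum, Fintype.sum_prod_type]
  have h2 : ∑ p : V × V with p.2 < p.1, a p.1 * a p.2
      = ∑ p : V × V with p.1 < p.2, a p.1 * a p.2 := by
    refine Finset.sum_nbij' Prod.swap Prod.swap ?_ ?_ ?_ ?_ ?_ <;> simp [mul_comm]
  have h3 : ∑ p : V × V with p.1 = p.2, a p.1 * a p.2 = ∑ k, a k ^ 2 := by
    refine (Finset.sum_nbij' (fun k => (k, k)) Prod.fst ?_ ?_ ?_ ?_ ?_).symm <;>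
      simp [sq]
  rw [h1, ← Finset.sum_filter_add_sum_filter_not _ (fun p : V × V => p.1 = p.2), h3,
    ← Finset.sum_filter_add_sum_filter_not (Finset.univ.filter fun p : V × V => ¬ p.1 = p.2)
      (fun p : V × V => p.1 < p.2), Finset.filter_filter, Finset.filter_filter]
  have h4 : (Finset.univ.filter fun p : V × V => ¬ p.1 = p.2 ∧ p.1 < p.2)
      = Finset.univ.filter fun p : V × V => p.1 < p.2 := by
    ext p; simp; intro h; exact h.ne
  have h5 : (Finset.univ.filter fun p : V × V => ¬ p.1 = p.2 ∧ ¬ p.1 < p.2)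
      = Finset.univ.filter fun p : V × V => p.2 < p.1 := by
    ext p; simp; constructor
    · rintro ⟨h, h'⟩; exact lt_of_le_of_ne h' (Ne.symm h)
    · intro h; exact ⟨h.ne', h.le⟩
  rw [h4, h5, h2]; ring

lemma integral_abs_le_sqrt_integral_sq {Ω : Type*} [Finite Ω] [MeasurableSpace Ω]
    [MeasurableSingletonClass Ω] {μ : Measure Ω} [IsProbabilityMeasure μ] (Y : Ω → ℝ) :
    ∫ ω, |Y ω| ∂μ ≤ √(∫ ω, Y ω ^ 2 ∂μ) := by
  apply Real.le_sqrt_of_sq_le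
  set m := ∫ ω, |Y ω| ∂μ with hm
  have h0 : 0 ≤ ∫ ω, (|Y ω| - m) ^ 2 ∂μ := integral_nonneg fun ω => sq_nonneg _
  have h1 : ∀ ω, (|Y ω| - m) ^ 2 = Y ω ^ 2 - 2 * m * |Y ω| + m ^ 2 := by
    intro ω; rw [sub_sq, sq_abs]; ring
  simp_rw [h1] at h0
  rw [integral_add .of_finite .of_finite, integral_sub .of_finite .of_finite,
    integral_const_mul, ← hm] at h0
  simp at h0
  nlinarith

lemma card_fourCycle {V : Type*} [DecidableEq V] {i j k l : V} (hij : i ≠ j) (hkl : k ≠ l)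
    (hik : i ≠ k) (hil : i ≠ l) (hjk : j ≠ k) (hjl : j ≠ l) :
    ({s(i, k), s(j, k), s(i, l), s(j, l)} : Finset (Sym2 V)).card = 4 := by
  rw [Finset.card_insert_of_notMem, Finset.card_insert_of_notMem, Finset.card_insert_of_notMem,
    Finset.card_singleton] <;> simp <;> grind

lemma prod_fourCycle {V : Type*} [DecidableEq V] {i j k l : V} (hij : i ≠ j) (hkl : k ≠ l)
    (hik : i ≠ k) (hil : i ≠ l) (hjk : j ≠ k) (hjl : j ≠ l) (f : Sym2 V → ℝ) :
    ∏ e ∈ ({s(i, k), s(j, k), s(i, l), s(j, l)} : Finset (Sym2 V)), f e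
      = f s(i, k) * f s(j, k) * (f s(i, l) * f s(j, l)) := by
  rw [Finset.prod_insert, Finset.prod_insert, Finset.prod_insert,
    Finset.prod_singleton, mul_assoc] <;> simp <;> grind

/-- The neighbours of `i` in the cycle are `k` and `l`, and `k < l` fixes their order; `j` is then
the remaining vertex. Fixing `i` matters: exchanging `i` and `j` gives the same cycle. -/
lemma fourCycle_injective {V : Type*} [LinearOrder V] {i j k l j' k' l' : V}
    (hij : i ≠ j) (hkl : k < l) (hik : i ≠ k) (hil : i ≠ l) (hjk : j ≠ k) (hjl : j ≠ l)
    (hij' : i ≠ j') (hkl' : k' < l') (hik' : i ≠ k')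
    (h : ({s(i, k), s(j, k), s(i, l), s(j, l)} : Finset (Sym2 V))
      = {s(i, k'), s(j', k'), s(i, l'), s(j', l')}) : j = j' ∧ k = k' ∧ l = l' := by
  have h1 : s(i, k) ∈ ({s(i, k'), s(j', k'), s(i, l'), s(j', l')} : Finset (Sym2 V)) := by
    rw [← h]; simp
  have h2 : s(i, l) ∈ ({s(i, k'), s(j', k'), s(i, l'), s(j', l')} : Finset (Sym2 V)) := by
    rw [← h]; simp
  have h3 : s(j, k) ∈ ({s(i, k'), s(j', k'), s(i, l'), s(j', l')} : Finset (Sym2 V)) := by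
    rw [← h]; simp
  simp only [Finset.mem_insert, Finset.mem_singleton, Sym2.eq_iff] at h1 h2 h3
  have hk : k = k' ∨ k = l' := by grind
  have hl : l = k' ∨ l = l' := by grind
  have : k = k' ∧ l = l' := by
    rcases hk with rfl | rfl <;> rcases hl with rfl | rfl
    · exact absurd hkl (lt_irrefl _)
    · exact ⟨rfl, rfl⟩
    · exact absurd hkl (lt_asymm hkl')
    · exact absurd hkl (lt_irrefl _)
  grind

/-- The `(i, j)` entry of the square of the symmetric matrix with entries `X s(i, j)`. -/
def pathSum {V Ω : Type*} [Fintype V] (X : Sym2 V → Ω → ℝ) (i j : V) (ω : Ω) : ℝ :=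
  ∑ k, X s(i, k) ω * X s(j, k) ω

/-- The sum of `X` over the four-cycles in which `i` and `j` are opposite. -/
def fourCycleSum {V Ω : Type*} [Fintype V] [LinearOrder V] (X : Sym2 V → Ω → ℝ) (i j : V)
    (ω : Ω) : ℝ :=
  ∑ p : V × V with p.1 < p.2,
    X s(i, p.1) ω * X s(j, p.1) ω * (X s(i, p.2) ω * X s(j, p.2) ω)

/-- The sum of the squares of the entries in row `k`. -/
def rowSqSum {V Ω : Type*} [Fintype V] (X : Sym2 V → Ω → ℝ) (k : V) (ω : Ω) : ℝ :=
  ∑ i, X s(i, k) ω ^ 2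

/-- In the expanded square, equal midpoints of the two paths give squared row sums, less the fourth
powers from `i = j`, and distinct midpoints give four-cycles. -/
lemma sum_pathSum_sq {V Ω : Type*} [Fintype V] [LinearOrder V] (X : Sym2 V → Ω → ℝ) (ω : Ω) :
    ∑ i, ∑ j with i ≠ j, pathSum X i j ω ^ 2
      = ∑ k, (rowSqSum X k ω ^ 2 - ∑ i, X s(i, k) ω ^ 4)
        + 2 * ∑ i, ∑ j with i ≠ j, fourCycleSum X i j ω := by
  have h1 : ∀ i j, pathSum X i j ω ^ 2
      = ∑ k, X s(i, k) ω ^ 2 * X s(j, k) ω ^ 2 + 2 * fourCycleSum X i j ω := by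
    intro i j
    simp_rw [← mul_pow]
    exact sq_sum_eq_sum_sq_add_two_mul _
  simp_rw [h1, Finset.sum_add_distrib, ← Finset.mul_sum]
  congr 1
  have h2 : ∀ i, ∑ j with i ≠ j, ∑ k, X s(i, k) ω ^ 2 * X s(j, k) ω ^ 2
      = ∑ k, (∑ j, X s(i, k) ω ^ 2 * X s(j, k) ω ^ 2 - X s(i, k) ω ^ 4) := by
    intro i
    rw [Finset.sum_comm]
    refine Finset.sum_congr rfl fun k _ => ?_
    rw [eq_sub_iff_add_eq, ← Finset.sum_filter_add_sum_filter_not Finset.univ (fun j => i ≠ j)]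
    congr 1
    simp only [ne_eq, not_not]
    rw [Finset.filter_eq]
    simp
    ring
  simp_rw [h2]
  rw [Finset.sum_comm]
  refine Finset.sum_congr rfl fun k _ => ?_
  rw [Finset.sum_sub_distrib, rowSqSum, sq (∑ i, _), Finset.sum_mul_sum]

/-! ### Moments of path sums and concentration of the conditional variance -/

namespace IsWignerArray

variable {V Ω : Type*} [Fintype V] [LinearOrder V] [Finite Ω] [MeasurableSpace Ω]
  [MeasurableSingletonClass Ω] {μ : Measure Ω} [IsProbabilityMeasure μ]
  {X : Sym2 V → Ω → ℝ} {v δ : ℝ}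

lemma apply_diag (h : IsWignerArray X μ v δ) (i : V) (ω : Ω) : X s(i, i) ω = 0 := by
  rw [h.diag _ (by simp)]; rfl

/-- Different midpoints `k` give different edge pairs, so Parseval leaves at most `n` terms `v²`,
and `n v² = v`. -/
lemma integral_pathSum_sq_le (h : IsWignerArray X μ v δ) (hv : Fintype.card V * v = 1)
    {i j : V} (hij : i ≠ j) : ∫ ω, pathSum X i j ω ^ 2 ∂μ ≤ v := by
  have h1 : ∀ ω, pathSum X i j ω = ∑ k with i ≠ k ∧ j ≠ k,
      ∏ e ∈ ({s(i, k), s(j, k)} : Finset (Sym2 V)), X e ω := by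
    intro ω
    rw [pathSum, Finset.sum_filter]
    refine Finset.sum_congr rfl fun k _ => ?_
    split_ifs with hk
    · rw [Finset.prod_pair]
      simp only [ne_eq, Sym2.eq_iff]; grind
    · have : k = i ∨ k = j := by grind
      rcases this with rfl | rfl <;> simp [h.apply_diag]
  simp_rw [h1]
  rw [h.integral_sum_prod_sq]
  · calc _ = ∑ k : V with i ≠ k ∧ j ≠ k, v ^ 2 := by
          refine Finset.sum_congr rfl fun k hk => ?_
          rw [Finset.card_pair]
          simp only [ne_eq, Sym2.eq_iff]; grind
      _ ≤ ∑ k : V, v ^ 2 :=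
          Finset.sum_le_univ_sum_of_nonneg fun _ => sq_nonneg _
      _ = v := by
          rw [Finset.sum_const, Finset.card_univ, nsmul_eq_mul, sq, ← mul_assoc, hv, one_mul]
  · intro k hk e he
    simp at hk he
    rcases he with rfl | rfl <;> simp [hk]
  · intro k hk k' hk' hkk
    simp at hk hk'
    have : s(i, k) ∈ ({s(i, k'), s(j, k')} : Finset (Sym2 V)) := by
      simp only at hkk; rw [← hkk]; simp
    simp only [Finset.mem_insert, Finset.mem_singleton, Sym2.eq_iff] at this
    grind

/-- For fixed `i` the cycles have distinct edge sets, so Parseval leaves at most `|J| n²` terms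
`v⁴`. Degenerate cycles contain a diagonal entry and vanish. -/
lemma integral_sum_fourCycleSum_sq_le (h : IsWignerArray X μ v δ)
    (hv : Fintype.card V * v = 1) {i : V} {J : Finset V} (hJ : i ∉ J) :
    ∫ ω, (∑ j ∈ J, fourCycleSum X i j ω) ^ 2 ∂μ ≤ J.card * v ^ 2 := by
  set I : Finset (V × V × V) := (J ×ˢ Finset.univ).filter fun q => q.2.1 < q.2.2 ∧
    (i ≠ q.2.1 ∧ i ≠ q.2.2 ∧ q.1 ≠ q.2.1 ∧ q.1 ≠ q.2.2) with hI
  have hmem : ∀ q ∈ I, i ≠ q.1 ∧ q.2.1 < q.2.2 ∧ i ≠ q.2.1 ∧ i ≠ q.2.2 ∧ q.1 ≠ q.2.1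
      ∧ q.1 ≠ q.2.2 := by
    rintro ⟨j, k, l⟩ hq
    simp [hI] at hq ⊢
    exact ⟨fun hij => hJ (hij ▸ hq.1), hq.2⟩
  have h1 : ∀ ω, ∑ j ∈ J, fourCycleSum X i j ω = ∑ q ∈ I,
      ∏ e ∈ ({s(i, q.2.1), s(q.1, q.2.1), s(i, q.2.2), s(q.1, q.2.2)} : Finset (Sym2 V)),
        X e ω := by
    intro ω
    simp only [fourCycleSum]
    rw [hI, Finset.sum_filter, Finset.sum_product]
    refine Finset.sum_congr rfl fun j hj => ?_
    rw [Finset.sum_filter]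
    refine Finset.sum_congr rfl fun p _ => ?_
    have hij : i ≠ j := fun hij => hJ (hij ▸ hj)
    by_cases hp : p.1 < p.2
    · by_cases hq : i ≠ p.1 ∧ i ≠ p.2 ∧ j ≠ p.1 ∧ j ≠ p.2
      · rw [if_pos hp, if_pos ⟨hp, hq⟩,
          prod_fourCycle hij hp.ne hq.1 hq.2.1 hq.2.2.1 hq.2.2.2 (fun e => X e ω)]
      · rw [if_pos hp, if_neg fun hc => hq hc.2]
        have : i = p.1 ∨ i = p.2 ∨ j = p.1 ∨ j = p.2 := by tauto
        rcases this with hh | hh | hh | hh <;> rw [← hh] <;> simp [h.apply_diag]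
    · rw [if_neg hp, if_neg fun hc => hp hc.1]
  simp_rw [h1]
  rw [h.integral_sum_prod_sq]
  · calc _ = ∑ q ∈ I, v ^ 4 := by
          refine Finset.sum_congr rfl fun q hq => ?_
          obtain ⟨a, b, c, d, e, f⟩ := hmem q hq
          rw [card_fourCycle a b.ne c d e f]
      _ ≤ ∑ q ∈ J ×ˢ (Finset.univ : Finset (V × V)), v ^ 4 :=
          Finset.sum_le_sum_of_subset_of_nonneg (Finset.filter_subset _ _)
            fun _ _ _ => by positivity
      _ = J.card * v ^ 2 * (Fintype.card V * v) ^ 2 := by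
          rw [Finset.sum_const, Finset.card_product, Finset.card_univ, Fintype.card_prod,
            nsmul_eq_mul]
          push_cast; ring
      _ = _ := by rw [hv]; ring
  · intro q hq e he
    obtain ⟨_, _, c, d, e', f⟩ := hmem q hq
    simp only [Finset.mem_insert, Finset.mem_singleton] at he
    rcases he with rfl | rfl | rfl | rfl <;> simpa using ‹_›
  · rintro ⟨j, k, l⟩ hq ⟨j', k', l'⟩ hq' heq
    obtain ⟨a, b, c, d, e, f⟩ := hmem _ hq
    obtain ⟨a', b', c', d', e', f'⟩ := hmem _ hq'
    obtain ⟨rfl, rfl, rfl⟩ := fourCycle_injective a b c d e f a' b' c' heq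
    rfl

lemma integral_sq (h : IsWignerArray X μ v δ) (e : Sym2 V) :
    ∫ ω, X e ω ^ 2 ∂μ = if e.IsDiag then 0 else v := by
  split_ifs with he
  · simp [h.diag e he]
  · exact h.var e he

lemma integral_sq_mul_sq_le (h : IsWignerArray X μ v δ) {e f : Sym2 V}
    (hef : e ≠ f) : ∫ ω, X e ω ^ 2 * X f ω ^ 2 ∂μ ≤ v ^ 2 := by
  by_cases he : e.IsDiag
  · simp [h.diag e he]; positivity
  by_cases hf : f.IsDiag
  · simp [h.diag f hf]; positivity
  have h1 := h.integral_prod_sq (s := {e, f}) (by simp [he, hf])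
  rw [Finset.card_pair hef] at h1
  simp_rw [Finset.prod_pair hef, mul_pow] at h1
  exact h1.le

lemma integral_fourCycle_sq_le (h : IsWignerArray X μ v δ) {i j k l : V}
    (hij : i ≠ j) (hkl : k ≠ l) :
    ∫ ω, (X s(i, k) ω * X s(j, k) ω) ^ 2 * (X s(i, l) ω * X s(j, l) ω) ^ 2 ∂μ ≤ v ^ 4 := by
  by_cases hq : i ≠ k ∧ i ≠ l ∧ j ≠ k ∧ j ≠ l
  · have h1 := h.integral_prod_sq (s := {s(i, k), s(j, k), s(i, l), s(j, l)}) (by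
      intro e he
      simp only [Finset.mem_insert, Finset.mem_singleton] at he
      rcases he with rfl | rfl | rfl | rfl <;> simp [hq])
    rw [card_fourCycle hij hkl hq.1 hq.2.1 hq.2.2.1 hq.2.2.2] at h1
    simp_rw [fun ω => prod_fourCycle hij hkl hq.1 hq.2.1 hq.2.2.1 hq.2.2.2 (fun e => X e ω)] at h1
    simp_rw [← mul_pow]
    exact h1.le
  · have : i = k ∨ i = l ∨ j = k ∨ j = l := by tauto
    have h0 : (0 : ℝ) ≤ v ^ 4 := by positivity
    rcases this with rfl | rfl | rfl | rfl <;> simpa [h.apply_diag] using h0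

lemma sq_le (h : IsWignerArray X μ v δ) (e : Sym2 V) (ω : Ω) : X e ω ^ 2 ≤ δ ^ 2 :=
  sq_le_sq' (neg_le_of_abs_le (h.bound e ω)) (le_of_abs_le (h.bound e ω))

/-- The terms `k = l` are fourth powers of a product bounded by `1`, hence at most its square: they
contribute `n v² = v`. The others contribute at most `n² v⁴ = v²`. -/
lemma integral_sum_sq_mul_sq_sq_le (h : IsWignerArray X μ v δ) (hv : Fintype.card V * v = 1)
    (hδ : δ ^ 2 ≤ 1) {i j : V} (hij : i ≠ j) :
    ∫ ω, (∑ k, (X s(i, k) ω * X s(j, k) ω) ^ 2) ^ 2 ∂μ ≤ v + v ^ 2 := by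
  have hterm : ∀ k l, ∫ ω, (X s(i, k) ω * X s(j, k) ω) ^ 2 * (X s(i, l) ω * X s(j, l) ω) ^ 2 ∂μ
      ≤ (if k = l then v ^ 2 else 0) + v ^ 4 := by
    intro k l
    split_ifs with hkl
    · subst hkl
      have h1 : ∫ ω, (X s(i, k) ω * X s(j, k) ω) ^ 2 * (X s(i, k) ω * X s(j, k) ω) ^ 2 ∂μ
          ≤ ∫ ω, X s(i, k) ω ^ 2 * X s(j, k) ω ^ 2 ∂μ := by
        refine integral_mono .of_finite .of_finite fun ω => ?_
        have a := (h.sq_le s(i, k) ω).trans hδ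
        have b := (h.sq_le s(j, k) ω).trans hδ
        have c : (X s(i, k) ω * X s(j, k) ω) ^ 2 ≤ 1 := by
          rw [mul_pow]; exact mul_le_one₀ a (sq_nonneg _) b
        simp only
        rw [← mul_pow (X s(i, k) ω)]
        exact mul_le_of_le_one_left (sq_nonneg _) c
      have h2 := h.integral_sq_mul_sq_le (e := s(i, k)) (f := s(j, k)) (by
        simp only [ne_eq, Sym2.eq_iff]; grind)
      have h0 : (0 : ℝ) ≤ v ^ 4 := by positivity
      linarith
    · rw [zero_add]
      exact h.integral_fourCycle_sq_le hij hkl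
  simp_rw [sq (∑ k, (_ : ℝ)), Finset.sum_mul_sum]
  rw [integral_finsetSum _ fun _ _ => .of_finite]
  calc _ ≤ ∑ k : V, ∑ l : V, ((if k = l then v ^ 2 else 0) + v ^ 4) := by
        refine Finset.sum_le_sum fun k _ => ?_
        rw [integral_finsetSum _ fun _ _ => .of_finite]
        exact Finset.sum_le_sum fun l _ => hterm k l
    _ = (Fintype.card V * v) * v + (Fintype.card V * v) ^ 2 * v ^ 2 := by
        simp [Finset.sum_add_distrib]; ring
    _ = _ := by rw [hv]; ring

lemma integral_pathSum_pow_four_le (h : IsWignerArray X μ v δ) (hv : Fintype.card V * v = 1)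
    (hv0 : 0 ≤ v) (hv1 : v ≤ 1) (hδ : δ ^ 2 ≤ 1) {i j : V} (hij : i ≠ j) :
    ∫ ω, pathSum X i j ω ^ 4 ∂μ ≤ 12 * v := by
  have h1 : ∀ ω, pathSum X i j ω ^ 4 ≤ 2 * (∑ k, (X s(i, k) ω * X s(j, k) ω) ^ 2) ^ 2
      + 8 * (∑ j ∈ {j}, fourCycleSum X i j ω) ^ 2 := by
    intro ω
    have h2 : pathSum X i j ω ^ 2 = _ := sq_sum_eq_sum_sq_add_two_mul _
    have h3 : pathSum X i j ω ^ 4 = (pathSum X i j ω ^ 2) ^ 2 := by ring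
    rw [h3, h2, Finset.sum_singleton, fourCycleSum]
    -- This is `(a + b)² ≤ 2a² + 2b²` with `b` twice the four-cycle sum, which explains the
    -- coefficients `2` and `8`.
    nlinarith [sq_nonneg (∑ k, (X s(i, k) ω * X s(j, k) ω) ^ 2 -
      2 * ∑ p : V × V with p.1 < p.2, X s(i, p.1) ω * X s(j, p.1) ω *
        (X s(i, p.2) ω * X s(j, p.2) ω))]
  refine (integral_mono .of_finite .of_finite h1).trans ?_
  rw [integral_add .of_finite .of_finite, integral_const_mul, integral_const_mul]
  have h4 := h.integral_sum_sq_mul_sq_sq_le hv hδ hij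
  have h5 := h.integral_sum_fourCycleSum_sq_le hv (i := i) (J := {j}) (by simpa using hij)
  simp only [Finset.card_singleton, Nat.cast_one, one_mul] at h5
  -- The total `2(v + v²) + 8v²` is at most `12v` because `v ≤ 1`.
  nlinarith

lemma integral_abs_pathSum_pow_three_le (h : IsWignerArray X μ v δ)
    (hv : Fintype.card V * v = 1)
    (hv0 : 0 ≤ v) (hv1 : v ≤ 1) (hδ : δ ^ 2 ≤ 1) {i j : V} (hij : i ≠ j) :
    ∫ ω, |pathSum X i j ω| ^ 3 ∂μ ≤ 7 * v := by
  have h1 : ∀ ω, |pathSum X i j ω| ^ 3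
      ≤ 2⁻¹ * pathSum X i j ω ^ 2 + 2⁻¹ * pathSum X i j ω ^ 4 := by
    intro ω
    rw [← sq_abs, ← Even.pow_abs (by decide : Even 4)]
    nlinarith [mul_nonneg (sq_nonneg |pathSum X i j ω|) (sq_nonneg (|pathSum X i j ω| - 1))]
  refine (integral_mono .of_finite .of_finite h1).trans ?_
  rw [integral_add .of_finite .of_finite, integral_const_mul, integral_const_mul]
  have h4 := h.integral_pathSum_sq_le hv hij
  have h5 := h.integral_pathSum_pow_four_le hv hv0 hv1 hδ hij
  linarith

lemma integral_rowSqSum (h : IsWignerArray X μ v δ) (hv : Fintype.card V * v = 1) (k : V) :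
    ∫ ω, rowSqSum X k ω ∂μ = 1 - v := by
  simp only [rowSqSum]
  rw [integral_finsetSum _ fun _ _ => .of_finite]
  simp_rw [h.integral_sq, Sym2.mk_isDiag_iff]
  -- The missing diagonal entry turns `n v = 1` into `1 - v`.
  have : ∀ i : V, (if i = k then 0 else v) = v - if i = k then v else 0 := by
    intro i; split_ifs <;> simp
  simp_rw [this]
  rw [Finset.sum_sub_distrib]
  simp [hv]

/-- Equal indices use `X⁴ ≤ δ² X²` and contribute `n δ² v = δ²`; distinct ones contribute at most
`n² v² = 1`. -/
lemma integral_rowSqSum_sq_le (h : IsWignerArray X μ v δ) (hv : Fintype.card V * v = 1)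
    (hv0 : 0 ≤ v) (k : V) :
    ∫ ω, rowSqSum X k ω ^ 2 ∂μ ≤ δ ^ 2 + 1 := by
  have hterm : ∀ i l, ∫ ω, X s(i, k) ω ^ 2 * X s(l, k) ω ^ 2 ∂μ
      ≤ (if i = l then δ ^ 2 * v else 0) + v ^ 2 := by
    intro i l
    split_ifs with hil
    · subst hil
      have h1 : ∫ ω, X s(i, k) ω ^ 2 * X s(i, k) ω ^ 2 ∂μ
          ≤ ∫ ω, δ ^ 2 * X s(i, k) ω ^ 2 ∂μ :=
        integral_mono .of_finite .of_finite fun ω =>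
          mul_le_mul_of_nonneg_right (h.sq_le s(i, k) ω) (sq_nonneg _)
      rw [integral_const_mul] at h1
      have h2 : ∫ ω, X s(i, k) ω ^ 2 ∂μ ≤ v := by
        rw [h.integral_sq]; split_ifs <;> linarith
      have := mul_le_mul_of_nonneg_left h2 (sq_nonneg δ)
      nlinarith
    · rw [zero_add]
      refine h.integral_sq_mul_sq_le ?_
      simp only [ne_eq, Sym2.eq_iff]; grind
  simp_rw [rowSqSum, sq (∑ k, (_ : ℝ)), Finset.sum_mul_sum]
  rw [integral_finsetSum _ fun _ _ => .of_finite]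
  calc _ ≤ ∑ i : V, ∑ l : V, ((if i = l then δ ^ 2 * v else 0) + v ^ 2) := by
        refine Finset.sum_le_sum fun k _ => ?_
        rw [integral_finsetSum _ fun _ _ => .of_finite]
        exact Finset.sum_le_sum fun l _ => hterm _ l
    _ = (Fintype.card V * v) * δ ^ 2 + (Fintype.card V * v) ^ 2 := by
        simp [Finset.sum_add_distrib]; ring
    _ = _ := by rw [hv]; ring

lemma integral_rowSqSum_sub_one_sq_le (h : IsWignerArray X μ v δ)
    (hv : Fintype.card V * v = 1) (hv0 : 0 ≤ v) (k : V) :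
    ∫ ω, (rowSqSum X k ω - 1) ^ 2 ∂μ ≤ δ ^ 2 + 2 * v := by
  have h1 : ∀ ω, (rowSqSum X k ω - 1) ^ 2 = rowSqSum X k ω ^ 2 - 2 * rowSqSum X k ω + 1 := by
    intro ω; ring
  simp_rw [h1]
  rw [integral_add .of_finite .of_finite, integral_sub .of_finite .of_finite,
    integral_const_mul, h.integral_rowSqSum hv]
  have := h.integral_rowSqSum_sq_le hv hv0 k
  simp
  linarith

/-- The conditional variance in the central limit theorem concentrates around `1`. -/
lemma integral_abs_sum_pathSum_sq_sub_one_le (h : IsWignerArray X μ v δ)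
    (hv : Fintype.card V * v = 1) (hv0 : 0 ≤ v) :
    ∫ ω, |v * ∑ i, ∑ j with i ≠ j, pathSum X i j ω ^ 2 - 1| ∂μ
      ≤ (2 * δ ^ 2 + 2 * v) + 2 * √(δ ^ 2 + 2 * v) + 2 * √v := by
  have h1 : ∀ ω, |v * ∑ i, ∑ j with i ≠ j, pathSum X i j ω ^ 2 - 1|
      ≤ v * ∑ k, ((rowSqSum X k ω - 1) ^ 2 + 2 * |rowSqSum X k ω - 1|
          + δ ^ 2 * rowSqSum X k ω)
        + v * (2 * ∑ i, |∑ j with i ≠ j, fourCycleSum X i j ω|) := by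
    intro ω
    -- Since `n v = 1`, the subtracted `1` is spread evenly over the rows.
    have h2 : v * ∑ i, ∑ j with i ≠ j, pathSum X i j ω ^ 2 - 1
        = v * ∑ k, (rowSqSum X k ω ^ 2 - 1 - ∑ i, X s(i, k) ω ^ 4)
          + v * (2 * ∑ i, ∑ j with i ≠ j, fourCycleSum X i j ω) := by
      rw [sum_pathSum_sq]
      have : ∑ k : V, (rowSqSum X k ω ^ 2 - 1 - ∑ i, X s(i, k) ω ^ 4)
          = ∑ k, (rowSqSum X k ω ^ 2 - ∑ i, X s(i, k) ω ^ 4) - Fintype.card V := by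
        rw [eq_sub_iff_add_eq, ← nsmul_one (Fintype.card V), ← Finset.card_univ,
          ← Finset.sum_const, ← Finset.sum_add_distrib]
        exact Finset.sum_congr rfl fun k _ => by ring
      rw [this]
      linear_combination hv
    rw [h2]
    refine (abs_add_le _ _).trans ?_
    rw [abs_mul, abs_mul, abs_mul, abs_of_nonneg hv0, abs_two]
    gcongr
    · refine (Finset.abs_sum_le_sum_abs _ _).trans (Finset.sum_le_sum fun k _ => ?_)
      have h3 : ∑ i, X s(i, k) ω ^ 4 ≤ δ ^ 2 * rowSqSum X k ω := by
        rw [rowSqSum, Finset.mul_sum]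
        refine Finset.sum_le_sum fun i _ => ?_
        have := mul_le_mul_of_nonneg_right (h.sq_le s(i, k) ω) (sq_nonneg (X s(i, k) ω))
        linarith [show X s(i, k) ω ^ 4 = X s(i, k) ω ^ 2 * X s(i, k) ω ^ 2 by ring]
      have h4 : 0 ≤ ∑ i, X s(i, k) ω ^ 4 := by positivity
      refine (abs_sub _ _).trans ?_
      rw [abs_of_nonneg h4]
      refine add_le_add ?_ h3
      rw [show rowSqSum X k ω ^ 2 - 1
        = (rowSqSum X k ω - 1) ^ 2 + 2 * (rowSqSum X k ω - 1) by ring]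
      refine (abs_add_le _ _).trans ?_
      rw [abs_of_nonneg (sq_nonneg _), abs_mul, abs_two]
    · exact Finset.abs_sum_le_sum_abs _ _
  refine (integral_mono .of_finite .of_finite h1).trans ?_
  rw [integral_add .of_finite .of_finite, integral_const_mul, integral_const_mul,
    integral_const_mul, integral_finsetSum _ fun _ _ => .of_finite,
    integral_finsetSum _ fun _ _ => .of_finite]
  have hrow : ∀ k : V, ∫ ω, ((rowSqSum X k ω - 1) ^ 2 + 2 * |rowSqSum X k ω - 1|
      + δ ^ 2 * rowSqSum X k ω) ∂μ ≤ (2 * δ ^ 2 + 2 * v) + 2 * √(δ ^ 2 + 2 * v) := by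
    intro k
    rw [integral_add .of_finite .of_finite, integral_add .of_finite .of_finite,
      integral_const_mul, integral_const_mul, h.integral_rowSqSum hv]
    have a := h.integral_rowSqSum_sub_one_sq_le hv hv0 k
    have b := (integral_abs_le_sqrt_integral_sq (μ := μ) (fun ω => rowSqSum X k ω - 1)).trans
      (Real.sqrt_le_sqrt a)
    nlinarith [mul_nonneg (sq_nonneg δ) hv0]
  -- Second moments are taken row by row, where four-cycle monomials are orthogonal; the prefactor
  -- `v` then averages over the `n` rows.
  have hcyc : ∀ i : V, ∫ ω, |∑ j with i ≠ j, fourCycleSum X i j ω| ∂μ ≤ √v := by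
    intro i
    refine (integral_abs_le_sqrt_integral_sq _).trans (Real.sqrt_le_sqrt ?_)
    refine (h.integral_sum_fourCycleSum_sq_le hv (by simp)).trans ?_
    calc _ ≤ (Fintype.card V : ℝ) * v ^ 2 := by
          gcongr
          exact Finset.card_le_univ _
      _ = v := by rw [sq, ← mul_assoc, hv, one_mul]
  have e1 := mul_le_mul_of_nonneg_left (Finset.sum_le_sum fun k (_ : k ∈ Finset.univ) => hrow k) hv0
  have e2 := mul_le_mul_of_nonneg_left (Finset.sum_le_sum fun k (_ : k ∈ Finset.univ) => hcyc k) hv0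
  rw [Finset.sum_const, Finset.card_univ, nsmul_eq_mul, ← mul_assoc, mul_comm v (Fintype.card V : ℝ), hv, one_mul]
    at e1 e2
  linarith

end IsWignerArray

/-! ### Dependence of the cubic trace on a single entry -/

/-- The trace of the cube of the symmetric matrix with entries `X s(i, j)`. -/
def cubeTrace {V Ω : Type*} [Fintype V] [DecidableEq V] (X : Sym2 V → Ω → ℝ) (ω : Ω) : ℝ :=
  Matrix.trace (Matrix.of (fun i j => X s(i, j) ω) ^ 3)

lemma trace_add_pow_three {V R : Type*} [Fintype V] [DecidableEq V] [CommRing R]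
    (M G : Matrix V V R) :
    Matrix.trace ((M + G) ^ 3) = Matrix.trace (M ^ 3) + 3 * Matrix.trace (M ^ 2 * G)
      + 3 * Matrix.trace (M * G ^ 2) + Matrix.trace (G ^ 3) := by
  have h1 : (M + G) ^ 3 = M ^ 3 + (M ^ 2 * G + M * G * M + G * M * M)
      + (M * G ^ 2 + G * M * G + G * G * M) + G ^ 3 := by noncomm_ring
  have h2 : Matrix.trace (M * G * M) = Matrix.trace (M ^ 2 * G) := by
    rw [Matrix.trace_mul_comm, ← mul_assoc, sq]
  have h3 : Matrix.trace (G * M * M) = Matrix.trace (M ^ 2 * G) := by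
    rw [mul_assoc, Matrix.trace_mul_comm, sq]
  have h4 : Matrix.trace (G * M * G) = Matrix.trace (M * G ^ 2) := by
    rw [mul_assoc, Matrix.trace_mul_comm, sq, mul_assoc]
  have h5 : Matrix.trace (G * G * M) = Matrix.trace (M * G ^ 2) := by
    rw [Matrix.trace_mul_comm, sq]
  rw [h1]
  simp only [Matrix.trace_add, h2, h3, h4, h5]
  ring

/-- The edge `s(i, j)` occurs only for `k = i` or `k = j`, where the other factor is a diagonal
entry. -/
lemma pathSum_update {V Ω : Type*} [Fintype V] [DecidableEq V] (X : Sym2 V → Ω → ℝ) (ω : Ω)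
    (hX : ∀ i, X s(i, i) ω = 0) {i j : V} (hij : i ≠ j) :
    pathSum (Function.update X s(i, j) 0) i j ω = pathSum X i j ω := by
  refine Finset.sum_congr rfl fun k _ => ?_
  by_cases hk : k = i
  · subst hk
    have h1 : s(k, k) ≠ s(k, j) := by simp only [ne_eq, Sym2.eq_iff]; grind
    rw [Function.update_of_ne h1, hX, zero_mul, zero_mul]
  by_cases hk' : k = j
  · subst hk'
    have h1 : s(k, k) ≠ s(i, k) := by simp only [ne_eq, Sym2.eq_iff]; grind
    rw [Function.update_of_ne h1, hX, mul_zero, mul_zero]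
  rw [Function.update_of_ne, Function.update_of_ne] <;>
    simp only [ne_eq, Sym2.eq_iff] <;> grind

/-- Write the matrix as `M + G`, with `G` supported on `(i, j)` and `(j, i)`. Then `tr(M G²)` sees
only the zero diagonal of `M`, `tr(G³) = 0`, and `3 tr(M² G)` counts the path sum twice, so the
dependence is affine. -/
lemma cubeTrace_eq_update_add {V Ω : Type*} [Fintype V] [DecidableEq V] (X : Sym2 V → Ω → ℝ)
    (ω : Ω) (hX : ∀ i, X s(i, i) ω = 0) {i j : V} (hij : i ≠ j) :
    cubeTrace X ω = cubeTrace (Function.update X s(i, j) 0) ω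
      + 6 * (X s(i, j) ω * pathSum X i j ω) := by
  set M : Matrix V V ℝ := Matrix.of fun a b => Function.update X s(i, j) 0 s(a, b) ω with hM
  set x := X s(i, j) ω
  have hMdiag : ∀ k, M k k = 0 := by
    intro k
    have h1 : s(k, k) ≠ s(i, j) := by simp only [ne_eq, Sym2.eq_iff]; grind
    rw [hM, Matrix.of_apply, Function.update_of_ne h1, hX]
  have hMsymm : ∀ a b, M a b = M b a := by
    intro a b
    rw [hM, Matrix.of_apply, Matrix.of_apply, Sym2.eq_swap (a := a)]
  have hdec : (Matrix.of fun a b => X s(a, b) ω)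
      = M + (Matrix.single i j x + Matrix.single j i x) := by
    ext a b
    simp only [Matrix.add_apply, Matrix.of_apply, hM, Matrix.single_apply]
    by_cases h1 : s(a, b) = s(i, j)
    · rw [h1, Function.update_self]
      rw [Sym2.eq_iff] at h1
      rcases h1 with ⟨rfl, rfl⟩ | ⟨rfl, rfl⟩ <;> simp [hij, hij.symm, x, Sym2.eq_swap]
    · rw [Function.update_of_ne h1]
      rw [Sym2.eq_iff] at h1
      rw [if_neg, if_neg] <;> grind
  have hG2 : (Matrix.single i j x + Matrix.single j i x) ^ 2
      = Matrix.single i i (x * x) + Matrix.single j j (x * x) := by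
    rw [sq, add_mul, mul_add, mul_add, Matrix.single_mul_single_same,
      Matrix.single_mul_single_same, Matrix.single_mul_single_of_ne _ _ _ _ hij.symm,
      Matrix.single_mul_single_of_ne _ _ _ _ hij]
    abel
  have hpath : (M ^ 2) i j = pathSum X i j ω := by
    rw [← pathSum_update X ω hX hij, sq, Matrix.mul_apply, pathSum]
    exact Finset.sum_congr rfl fun k _ => by rw [hMsymm k j]; rfl
  have hpath' : (M ^ 2) j i = (M ^ 2) i j := by
    rw [sq, Matrix.mul_apply, Matrix.mul_apply]
    exact Finset.sum_congr rfl fun k _ => by rw [hMsymm k i, hMsymm j k, mul_comm]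
  rw [cubeTrace, hdec, trace_add_pow_three, pow_succ (_ + _) 2, hG2]
  simp only [mul_add, add_mul, Matrix.trace_add, Matrix.trace_mul_single, hpath, hpath', hMdiag,
    Matrix.single_mul_single_same, Matrix.single_mul_single_of_ne _ _ _ _ hij.symm,
    Matrix.single_mul_single_of_ne _ _ _ _ hij, Matrix.trace_single_eq_of_ne _ _ _ hij,
    Matrix.trace_single_eq_of_ne _ _ _ hij.symm, Matrix.trace_zero]
  simp only [cubeTrace, ← hM]
  simp
  ring

lemma cubeTrace_eq_sum {V Ω : Type*} [Fintype V] [DecidableEq V] (X : Sym2 V → Ω → ℝ)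
    (ω : Ω) (hX : ∀ i, X s(i, i) ω = 0) :
    cubeTrace X ω = ∑ i, ∑ j with i ≠ j, X s(i, j) ω * pathSum X i j ω := by
  rw [cubeTrace, pow_succ', Matrix.trace]
  refine Finset.sum_congr rfl fun i _ => ?_
  rw [Matrix.diag_apply, Matrix.mul_apply, Finset.sum_filter]
  refine Finset.sum_congr rfl fun j _ => ?_
  split_ifs with hij
  · rw [Matrix.of_apply, sq, Matrix.mul_apply, pathSum]
    congr 1
    refine Finset.sum_congr rfl fun k _ => ?_
    rw [Matrix.of_apply, Matrix.of_apply, mul_comm, Sym2.eq_swap]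
  · rw [not_not] at hij
    subst hij
    rw [Matrix.of_apply, hX, zero_mul]

lemma norm_exp_ofReal_mul_I_sub_one_le (y : ℝ) :
    ‖Complex.exp (y * Complex.I) - 1‖ ≤ |y| := by
  rw [mul_comm]
  exact Real.norm_exp_I_mul_ofReal_sub_one_le

lemma norm_exp_ofReal_mul_I_sub_one_sub_le (y : ℝ) :
    ‖Complex.exp (y * Complex.I) - 1 - y * Complex.I‖ ≤ 2 * y ^ 2 := by
  have hn : ‖(y : ℂ) * Complex.I‖ = |y| := by simp
  rcases le_total |y| 1 with h | h
  · have := Complex.norm_exp_sub_one_sub_id_le (x := y * Complex.I) (by rwa [hn])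
    rw [hn, sq_abs] at this
    nlinarith [sq_nonneg y]
  -- For `|y| ≥ 1` the crude bound `|y| + |y| ≤ 2y²` suffices.
  · refine (norm_sub_le _ _).trans ?_
    rw [hn]
    have := norm_exp_ofReal_mul_I_sub_one_le y
    nlinarith [sq_abs y]

/-! ### Approximate Gaussian integration by parts -/

namespace IsWignerArray

variable {V Ω : Type*} [Fintype V] [LinearOrder V] [Finite Ω] [MeasurableSpace Ω]
  [MeasurableSingletonClass Ω] {μ : Measure Ω} [IsProbabilityMeasure μ]
  {X : Sym2 V → Ω → ℝ} {v δ : ℝ}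

lemma indepFun_update (h : IsWignerArray X μ v δ) (e : Sym2 V) :
    IndepFun (X e) (fun ω f => Function.update X e 0 f ω) μ := by
  have h1 := h.indep.indepFun_finset {e} {e}ᶜ disjoint_compl_right
    (fun _ => .of_discrete)
  have hφ : Measurable fun x : ({e} : Finset (Sym2 V)) → ℝ => x ⟨e, by simp⟩ :=
    measurable_pi_apply _
  have hψ : Measurable fun (x : ({e}ᶜ : Finset (Sym2 V)) → ℝ) (f : Sym2 V) =>
      if hf : f ∈ ({e}ᶜ : Finset (Sym2 V)) then x ⟨f, hf⟩ else 0 := by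
    refine measurable_pi_lambda _ fun f => ?_
    split_ifs <;> fun_prop
  have h2 := h1.comp hφ hψ
  have h3 : (fun ω f => Function.update X e 0 f ω) =
      (fun (x : ({e}ᶜ : Finset (Sym2 V)) → ℝ) (f : Sym2 V) =>
        if hf : f ∈ ({e}ᶜ : Finset (Sym2 V)) then x ⟨f, hf⟩ else 0) ∘ fun ω i => X i ω := by
    funext ω f
    by_cases hf : f = e
    · subst hf; simp
    · simp [hf]
  rw [h3]
  exact h2

/-- Integrating out one entry of the array against a function of the other entries. -/
lemma integral_mul_comp_update (h : IsWignerArray X μ v δ) (e : Sym2 V) {g : ℝ → ℂ}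
    (hg : Measurable g) {Ψ : (Sym2 V → ℝ) → ℂ} (hΨ : Measurable Ψ) :
    ∫ ω, g (X e ω) * Ψ (fun f => Function.update X e 0 f ω) ∂μ
      = (∫ ω, g (X e ω) ∂μ) * ∫ ω, Ψ (fun f => Function.update X e 0 f ω) ∂μ :=
  (h.indepFun_update e).integral_fun_comp_mul_comp
    Measurable.of_discrete.aemeasurable Measurable.of_discrete.aemeasurable
    hg.aestronglyMeasurable hΨ.aestronglyMeasurable

/-- Gaussian integration by parts for one entry of the array, up to an error term. -/
lemma norm_integral_mul_exp_sub_le (h : IsWignerArray X μ v δ) (hv0 : 0 ≤ v) {i j : V}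
    (hij : i ≠ j) (t : ℝ) :
    ‖∫ ω, ((X s(i, j) ω * pathSum X i j ω : ℝ) : ℂ)
          * Complex.exp ((t * (cubeTrace X ω / √6) : ℝ) * Complex.I) ∂μ
        - v * √6 * Complex.I * t * ∫ ω, ((pathSum X i j ω ^ 2 : ℝ) : ℂ)
          * Complex.exp ((t * (cubeTrace X ω / √6) : ℝ) * Complex.I) ∂μ‖
      ≤ 18 * t ^ 2 * δ * v * ∫ ω, |pathSum X i j ω| ^ 3 ∂μ := by
  set e := s(i, j) with he
  set x := X e with hx
  set D := pathSum X i j with hD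
  set W := fun ω => cubeTrace X ω / √6 with hW
  set W₀ := fun ω => cubeTrace (Function.update X e 0) ω / √6 with hW₀
  set f : ℝ → ℂ := fun w => Complex.exp ((t * w : ℝ) * Complex.I) with hf
  have hδ : 0 ≤ δ := by
    obtain ⟨ω⟩ := nonempty_of_isProbabilityMeasure μ
    exact (abs_nonneg _).trans (h.bound e ω)
  have hediag : ¬ e.IsDiag := by simpa [he] using hij
  have h6 : √6 * √6 = (6 : ℝ) := Real.mul_self_sqrt (by norm_num)
  have h6' : (0 : ℝ) < √6 := by positivity
  have hWdec : ∀ ω, W ω = W₀ ω + √6 * (x ω * D ω) := by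
    intro ω
    simp only [hW, hW₀]
    rw [cubeTrace_eq_update_add X ω (fun k => h.apply_diag k ω) hij]
    field_simp
    rw [Real.sq_sqrt (by norm_num)]
  have hfdec : ∀ ω, f (W ω) = f (W₀ ω)
      * Complex.exp (((t * √6 * (x ω * D ω) : ℝ) : ℂ) * Complex.I) := by
    intro ω
    simp only [hf]
    rw [← Complex.exp_add, hWdec]
    congr 1
    push_cast; ring
  have hfn : ∀ w, ‖f w‖ = 1 := fun w => Complex.norm_exp_ofReal_mul_I _
  -- Functions of the other entries.
  have hDup : ∀ ω, D ω = ∑ k, Function.update X e 0 s(i, k) ω * Function.update X e 0 s(j, k) ω :=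
    fun ω => (pathSum_update X ω (fun k => h.apply_diag k ω) hij).symm
  have hΨ : ∀ m : ℕ, Measurable fun y : Sym2 V → ℝ =>
      (((∑ k, y s(i, k) * y s(j, k)) ^ m : ℝ) : ℂ)
        * f (Matrix.trace (Matrix.of (fun i j => y s(i, j)) ^ 3) / √6) := by
    intro m
    simp only [hf, Matrix.trace, Matrix.diag, pow_three, Matrix.mul_apply, Matrix.of_apply]
    fun_prop
  have hindep : ∀ (m : ℕ) (g : ℝ → ℂ), Measurable g →
      ∫ ω, g (x ω) * (((D ω ^ m : ℝ) : ℂ) * f (W₀ ω)) ∂μ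
        = (∫ ω, g (x ω) ∂μ) * ∫ ω, ((D ω ^ m : ℝ) : ℂ) * f (W₀ ω) ∂μ := by
    intro m g hg
    have := h.integral_mul_comp_update e hg (hΨ m)
    simp_rw [← hDup] at this
    exact this
  have hmean : ∫ ω, (x ω : ℂ) * (((D ω ^ 1 : ℝ) : ℂ) * f (W₀ ω)) ∂μ = 0 := by
    rw [hindep 1 (fun x => (x : ℂ)) (by fun_prop), integral_complex_ofReal, h.mean e hediag]
    simp
  have hvar : ∫ ω, ((x ω ^ 2 : ℝ) : ℂ) * (((D ω ^ 2 : ℝ) : ℂ) * f (W₀ ω)) ∂μ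
      = v * ∫ ω, ((D ω ^ 2 : ℝ) : ℂ) * f (W₀ ω) ∂μ := by
    rw [hindep 2 (fun x => ((x ^ 2 : ℝ) : ℂ)) (by fun_prop), integral_complex_ofReal,
      h.var e hediag]
  -- Independence extracts `v` from `x²`, so only one of the three powers of `x` in the Taylor
  -- remainder is bounded by `δ`.
  have hcube : ∫ ω, x ω ^ 2 * |D ω| ^ 3 ∂μ = v * ∫ ω, |D ω| ^ 3 ∂μ := by
    have := (h.indepFun_update e).integral_fun_comp_mul_comp (f := fun x => x ^ 2)
      (g := fun y => |∑ k, y s(i, k) * y s(j, k)| ^ 3)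
      Measurable.of_discrete.aemeasurable Measurable.of_discrete.aemeasurable
      (by fun_prop) (by fun_prop)
    simp_rw [← hDup] at this
    rw [this, h.var e hediag]
  -- The first integral is the second-order Taylor remainder around `W₀`; the subtracted first-order
  -- term has mean zero. The second integral is the cost of replacing `W₀` by `W` in the variance
  -- term.
  have hkey : (∫ ω, ((x ω * D ω : ℝ) : ℂ) * f (W ω) ∂μ)
        - v * √6 * Complex.I * t * ∫ ω, ((D ω ^ 2 : ℝ) : ℂ) * f (W ω) ∂μ
      = ∫ ω, (((x ω * D ω : ℝ) : ℂ) * f (W ω)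
          - (x ω : ℂ) * (((D ω ^ 1 : ℝ) : ℂ) * f (W₀ ω))
          - √6 * Complex.I * t * (((x ω ^ 2 : ℝ) : ℂ) * (((D ω ^ 2 : ℝ) : ℂ) * f (W₀ ω)))) ∂μ
        - v * √6 * Complex.I * t
          * ∫ ω, (((D ω ^ 2 : ℝ) : ℂ) * f (W ω) - ((D ω ^ 2 : ℝ) : ℂ) * f (W₀ ω)) ∂μ := by
    rw [integral_sub .of_finite .of_finite, integral_sub .of_finite .of_finite,
      integral_sub .of_finite .of_finite, integral_const_mul, hmean, hvar]
    ring
  have herr1 : ∀ ω, ‖((x ω * D ω : ℝ) : ℂ) * f (W ω)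
          - (x ω : ℂ) * (((D ω ^ 1 : ℝ) : ℂ) * f (W₀ ω))
          - √6 * Complex.I * t * (((x ω ^ 2 : ℝ) : ℂ) * (((D ω ^ 2 : ℝ) : ℂ) * f (W₀ ω)))‖
      ≤ 12 * t ^ 2 * δ * (x ω ^ 2 * |D ω| ^ 3) := by
    intro ω
    set y : ℝ := t * √6 * (x ω * D ω) with hy
    have h1 : ((x ω * D ω : ℝ) : ℂ) * f (W ω)
          - (x ω : ℂ) * (((D ω ^ 1 : ℝ) : ℂ) * f (W₀ ω))
          - √6 * Complex.I * t * (((x ω ^ 2 : ℝ) : ℂ) * (((D ω ^ 2 : ℝ) : ℂ) * f (W₀ ω)))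
        = ((x ω * D ω : ℝ) : ℂ) * f (W₀ ω)
          * (Complex.exp (y * Complex.I) - 1 - y * Complex.I) := by
      rw [hfdec ω, ← hy]
      have : (y : ℂ) = t * √6 * (x ω * D ω) := by rw [hy]; push_cast; ring
      rw [this]
      push_cast; ring
    rw [h1, norm_mul, norm_mul, hfn, mul_one, Complex.norm_real, Real.norm_eq_abs, abs_mul]
    have h2 := norm_exp_ofReal_mul_I_sub_one_sub_le y
    have h3 : 2 * y ^ 2 = 12 * t ^ 2 * (|x ω| ^ 2 * |D ω| ^ 2) := by
      rw [hy, sq_abs, sq_abs]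
      linear_combination 2 * t ^ 2 * (x ω * D ω) ^ 2 * h6
    calc _ ≤ |x ω| * |D ω| * (2 * y ^ 2) := by gcongr
      _ = 12 * t ^ 2 * |x ω| * (x ω ^ 2 * |D ω| ^ 3) := by rw [h3, ← sq_abs (x ω)]; ring
      _ ≤ _ := by gcongr; exact h.bound e ω
  have herr2 : ∀ ω, ‖((D ω ^ 2 : ℝ) : ℂ) * f (W ω) - ((D ω ^ 2 : ℝ) : ℂ) * f (W₀ ω)‖
      ≤ |t| * √6 * δ * |D ω| ^ 3 := by
    intro ω
    have h1 : ((D ω ^ 2 : ℝ) : ℂ) * f (W ω) - ((D ω ^ 2 : ℝ) : ℂ) * f (W₀ ω)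
        = ((D ω ^ 2 : ℝ) : ℂ) * f (W₀ ω) * (Complex.exp
          (((t * √6 * (x ω * D ω) : ℝ) : ℂ) * Complex.I) - 1) := by
      rw [hfdec ω]; ring
    rw [h1, norm_mul, norm_mul, hfn, mul_one, Complex.norm_real, Real.norm_eq_abs,
      abs_of_nonneg (sq_nonneg _)]
    calc _ ≤ D ω ^ 2 * |t * √6 * (x ω * D ω)| := by
          gcongr
          exact norm_exp_ofReal_mul_I_sub_one_le _
      _ = |t| * √6 * |x ω| * |D ω| ^ 3 := by
          rw [abs_mul, abs_mul, abs_mul, abs_of_pos h6', ← sq_abs (D ω)]; ring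
      _ ≤ _ := by gcongr; exact h.bound e ω
  change ‖(∫ ω, ((x ω * D ω : ℝ) : ℂ) * f (W ω) ∂μ)
        - v * √6 * Complex.I * t * ∫ ω, ((D ω ^ 2 : ℝ) : ℂ) * f (W ω) ∂μ‖ ≤ _
  rw [hkey]
  refine (norm_sub_le _ _).trans ?_
  have b1 := (norm_integral_le_integral_norm _).trans
    (integral_mono (μ := μ) .of_finite .of_finite herr1)
  have b2 := (norm_integral_le_integral_norm _).trans
    (integral_mono (μ := μ) .of_finite .of_finite herr2)
  rw [integral_const_mul, hcube] at b1
  rw [integral_const_mul] at b2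
  have hn : ‖(v : ℂ) * √6 * Complex.I * t‖ = v * √6 * |t| := by
    simp [abs_of_nonneg hv0]
  rw [norm_mul, hn]
  -- The Taylor remainder contributes `12 = 2 · 6` and the replacement of `W₀` contributes `√6 · √6
  -- = 6`, for a total of `18`.
  calc _ ≤ 12 * t ^ 2 * δ * (v * ∫ ω, |D ω| ^ 3 ∂μ)
        + v * √6 * |t| * (|t| * √6 * δ * ∫ ω, |D ω| ^ 3 ∂μ) := by gcongr
    _ = _ := by
      rw [← sq_abs t]
      linear_combination v * |t| ^ 2 * δ * (∫ ω, |D ω| ^ 3 ∂μ) * h6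

end IsWignerArray

/-! ### Stein's equation for the characteristic function -/

namespace IsWignerArray

variable {V Ω : Type*} [Fintype V] [LinearOrder V] [Finite Ω] [MeasurableSpace Ω]
  [MeasurableSingletonClass Ω] {μ : Measure Ω} [IsProbabilityMeasure μ]
  {X : Sym2 V → Ω → ℝ} {v δ : ℝ}

/-- Stein's equation for the trace of the cube, up to an error term. -/
lemma norm_integral_cubeTrace_mul_exp_sub_le (h : IsWignerArray X μ v δ)
    (hv : Fintype.card V * v = 1) (hv0 : 0 ≤ v) (hv1 : v ≤ 1) (hδ0 : 0 ≤ δ) (hδ : δ ^ 2 ≤ 1)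
    (t : ℝ) :
    ‖∫ ω, ((cubeTrace X ω / √6 : ℝ) : ℂ)
          * Complex.exp ((t * (cubeTrace X ω / √6) : ℝ) * Complex.I) ∂μ
        - Complex.I * t * ∫ ω, Complex.exp ((t * (cubeTrace X ω / √6) : ℝ) * Complex.I) ∂μ‖
      ≤ 126 * δ * t ^ 2
        + ((2 * δ ^ 2 + 2 * v) + 2 * √(δ ^ 2 + 2 * v) + 2 * √v) * |t| := by
  set W := fun ω => cubeTrace X ω / √6 with hW
  set f : ℝ → ℂ := fun w => Complex.exp ((t * w : ℝ) * Complex.I) with hf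
  have hfn : ∀ w, ‖f w‖ = 1 := fun w => Complex.norm_exp_ofReal_mul_I _
  change ‖(∫ ω, (W ω : ℂ) * f (W ω) ∂μ) - Complex.I * t * ∫ ω, f (W ω) ∂μ‖ ≤ _
  have h6 : √6 * √6 = (6 : ℝ) := Real.mul_self_sqrt (by norm_num)
  have h6' : (0 : ℝ) < √6 := by positivity
  have h61 : (1 : ℝ) ≤ √6 := by rw [Real.one_le_sqrt]; norm_num
  have hWsum : ∫ ω, (W ω : ℂ) * f (W ω) ∂μ
      = (√6 : ℂ)⁻¹ * ∑ i, ∑ j with i ≠ j,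
        ∫ ω, ((X s(i, j) ω * pathSum X i j ω : ℝ) : ℂ) * f (W ω) ∂μ := by
    have h1 : ∀ ω, (W ω : ℂ) * f (W ω) = (√6 : ℂ)⁻¹ * ∑ i, ∑ j with i ≠ j,
        ((X s(i, j) ω * pathSum X i j ω : ℝ) : ℂ) * f (W ω) := by
      intro ω
      simp_rw [← Finset.sum_mul]
      rw [← mul_assoc]
      congr 1
      simp only [hW]
      rw [cubeTrace_eq_sum X ω fun k => h.apply_diag k ω]
      push_cast
      rw [div_eq_inv_mul]
    simp_rw [h1]
    rw [integral_const_mul, integral_finsetSum _ fun _ _ => .of_finite]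
    congr 1
    exact Finset.sum_congr rfl fun i _ => integral_finsetSum _ fun _ _ => .of_finite
  have hVsum : ∫ ω, ((v * ∑ i, ∑ j with i ≠ j, pathSum X i j ω ^ 2 : ℝ) : ℂ) * f (W ω) ∂μ
      = v * ∑ i, ∑ j with i ≠ j, ∫ ω, ((pathSum X i j ω ^ 2 : ℝ) : ℂ) * f (W ω) ∂μ := by
    have h1 : ∀ ω, ((v * ∑ i, ∑ j with i ≠ j, pathSum X i j ω ^ 2 : ℝ) : ℂ) * f (W ω)
        = v * ∑ i, ∑ j with i ≠ j, ((pathSum X i j ω ^ 2 : ℝ) : ℂ) * f (W ω) := by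
      intro ω
      simp_rw [← Finset.sum_mul]
      push_cast
      ring
    simp_rw [h1]
    rw [integral_const_mul, integral_finsetSum _ fun _ _ => .of_finite]
    congr 1
    exact Finset.sum_congr rfl fun i _ => integral_finsetSum _ fun _ _ => .of_finite
  have hdec : (∫ ω, (W ω : ℂ) * f (W ω) ∂μ) - Complex.I * t * ∫ ω, f (W ω) ∂μ
      = (√6 : ℂ)⁻¹ * ∑ i, ∑ j with i ≠ j,
          ((∫ ω, ((X s(i, j) ω * pathSum X i j ω : ℝ) : ℂ) * f (W ω) ∂μ)
            - v * √6 * Complex.I * t * ∫ ω, ((pathSum X i j ω ^ 2 : ℝ) : ℂ) * f (W ω) ∂μ)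
        + Complex.I * t * ∫ ω, ((v * ∑ i, ∑ j with i ≠ j, pathSum X i j ω ^ 2 - 1 : ℝ) : ℂ)
            * f (W ω) ∂μ := by
    have h1 : ∫ ω, ((v * ∑ i, ∑ j with i ≠ j, pathSum X i j ω ^ 2 - 1 : ℝ) : ℂ) * f (W ω) ∂μ
        = ∫ ω, ((v * ∑ i, ∑ j with i ≠ j, pathSum X i j ω ^ 2 : ℝ) : ℂ) * f (W ω) ∂μ
          - ∫ ω, f (W ω) ∂μ := by
      rw [← integral_sub .of_finite .of_finite]
      congr 1 with ω
      push_cast; ring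
    rw [h1, hWsum, hVsum]
    simp_rw [Finset.sum_sub_distrib, ← Finset.mul_sum]
    have h6c : (√6 : ℂ) ≠ 0 := by exact_mod_cast h6'.ne'
    field_simp
    ring
  rw [hdec]
  refine (norm_add_le _ _).trans (add_le_add ?_ ?_)
  · rw [norm_mul, norm_inv, Complex.norm_real, Real.norm_eq_abs, abs_of_pos h6']
    -- Here `126 = 18 · 7`, from integration by parts and the third absolute moment; the factor `v²`
    -- cancels the number of pairs.
    have hterm : ∀ i j, i ≠ j →
        ‖(∫ ω, ((X s(i, j) ω * pathSum X i j ω : ℝ) : ℂ) * f (W ω) ∂μ)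
            - v * √6 * Complex.I * t * ∫ ω, ((pathSum X i j ω ^ 2 : ℝ) : ℂ) * f (W ω) ∂μ‖
          ≤ 126 * t ^ 2 * δ * v ^ 2 := by
      intro i j hij
      refine (h.norm_integral_mul_exp_sub_le hv0 hij t).trans ?_
      have := h.integral_abs_pathSum_pow_three_le hv hv0 hv1 hδ hij
      calc _ ≤ 18 * t ^ 2 * δ * v * (7 * v) := by gcongr
        _ = _ := by ring
    calc _ ≤ (√6)⁻¹ * ∑ i : V, ∑ j : V, 126 * t ^ 2 * δ * v ^ 2 := by
          gcongr
          refine (norm_sum_le _ _).trans (Finset.sum_le_sum fun i _ => ?_)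
          refine (norm_sum_le _ _).trans ((Finset.sum_le_sum fun j hj =>
            hterm i j (by simpa using hj)).trans ?_)
          exact Finset.sum_le_univ_sum_of_nonneg fun _ => by positivity
      _ = (√6)⁻¹ * ((Fintype.card V * v) ^ 2 * (126 * δ * t ^ 2)) := by
          simp; ring
      _ ≤ _ := by
          rw [hv, one_pow, one_mul]
          exact mul_le_of_le_one_left (by positivity) (inv_le_one_of_one_le₀ h61)
  · rw [norm_mul, norm_mul, Complex.norm_I, one_mul, Complex.norm_real, Real.norm_eq_abs,
      mul_comm]
    gcongr
    refine (norm_integral_le_integral_norm _).trans ?_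
    simp_rw [norm_mul, hfn, mul_one, Complex.norm_real, Real.norm_eq_abs]
    exact h.integral_abs_sum_pathSum_sq_sub_one_le hv hv0

end IsWignerArray

/-- With the integrating factor, `φ(s) exp(s²/2)` has derivative `(φ'(s) + s φ(s)) exp(s²/2)`; the
mean value inequality on `[-|t|, |t|]` gives the bound. -/
lemma norm_mul_exp_sub_one_le {φ φ' : ℝ → ℂ} (hφ : ∀ t, HasDerivAt φ (φ' t) t) (h0 : φ 0 = 1)
    {a b : ℝ} (ha : 0 ≤ a) (hb : 0 ≤ b)
    (hbound : ∀ t : ℝ, ‖φ' t + t * φ t‖ ≤ a * t ^ 2 + b * |t|) (t : ℝ) :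
    ‖φ t * Complex.exp ((t ^ 2 / 2 : ℝ)) - 1‖
      ≤ (a * t ^ 2 + b * |t|) * Real.exp (t ^ 2 / 2) * |t| := by
  have hderiv : ∀ s : ℝ, HasDerivAt (fun s : ℝ => φ s * Complex.exp ((s ^ 2 / 2 : ℝ)))
      ((φ' s + s * φ s) * Complex.exp ((s ^ 2 / 2 : ℝ))) s := by
    intro s
    have h1 : HasDerivAt (fun s : ℝ => s ^ 2 / 2) s s := by
      simpa using (hasDerivAt_pow 2 s).div_const 2
    convert! (hφ s).mul h1.ofReal_comp.cexp using 1
    ring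
  have hmem : ∀ s ∈ Set.Icc (-|t|) |t|,
      ‖(φ' s + s * φ s) * Complex.exp ((s ^ 2 / 2 : ℝ))‖
        ≤ (a * t ^ 2 + b * |t|) * Real.exp (t ^ 2 / 2) := by
    intro s hs
    have h1 : |s| ≤ |t| := abs_le.mpr hs
    have h2 : s ^ 2 ≤ t ^ 2 := sq_le_sq.mpr h1
    rw [norm_mul, Complex.norm_exp, Complex.ofReal_re]
    gcongr
    exact (hbound s).trans (by gcongr)
  have := (convex_Icc (-|t|) |t|).norm_image_sub_le_of_norm_hasDerivWithin_le
    (fun s _ => (hderiv s).hasDerivWithinAt) hmem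
    (show (0 : ℝ) ∈ Set.Icc (-|t|) |t| by simp) (show t ∈ Set.Icc (-|t|) |t| from
      ⟨neg_abs_le t, le_abs_self t⟩)
  simpa [h0] using this

namespace IsWignerArray

variable {V Ω : Type*} [Fintype V] [LinearOrder V] [Finite Ω] [MeasurableSpace Ω]
  [MeasurableSingletonClass Ω] {μ : Measure Ω} [IsProbabilityMeasure μ]
  {X : Sym2 V → Ω → ℝ} {v δ : ℝ}

/-- Comparison of the characteristic function of the normalised trace of the cube with the
standard Gaussian one. -/
lemma norm_integral_exp_mul_exp_sub_one_le (h : IsWignerArray X μ v δ)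
    (hv : Fintype.card V * v = 1) (hv0 : 0 ≤ v) (hv1 : v ≤ 1) (hδ0 : 0 ≤ δ) (hδ : δ ^ 2 ≤ 1)
    (t : ℝ) :
    ‖(∫ ω, Complex.exp ((t * (cubeTrace X ω / √6) : ℝ) * Complex.I) ∂μ)
        * Complex.exp ((t ^ 2 / 2 : ℝ)) - 1‖
      ≤ (126 * δ * t ^ 2 + ((2 * δ ^ 2 + 2 * v) + 2 * √(δ ^ 2 + 2 * v) + 2 * √v) * |t|)
        * Real.exp (t ^ 2 / 2) * |t| := by
  have := Fintype.ofFinite Ω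
  refine norm_mul_exp_sub_one_le
    (φ := fun t => ∫ ω, Complex.exp ((t * (cubeTrace X ω / √6) : ℝ) * Complex.I) ∂μ)
    (φ' := fun t => Complex.I * ∫ ω, ((cubeTrace X ω / √6 : ℝ) : ℂ)
          * Complex.exp ((t * (cubeTrace X ω / √6) : ℝ) * Complex.I) ∂μ)
    ?_ (by simp) (by positivity) (by positivity) ?_ t
  · intro s
    -- On a finite space the characteristic function is a finite sum of exponentials, differentiated
    -- term by term.
    simp_rw [integral_fintype .of_finite, Finset.mul_sum]
    refine HasDerivAt.fun_sum fun ω _ => ?_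
    have h1 : HasDerivAt (fun s : ℝ => s * (cubeTrace X ω / √6)) (cubeTrace X ω / √6) s :=
      hasDerivAt_mul_const _
    convert! (((h1.ofReal_comp).mul_const Complex.I).cexp).const_smul (μ.real {ω}) using 1
    simp only [Complex.real_smul]
    ring
  · intro s
    have h1 := h.norm_integral_cubeTrace_mul_exp_sub_le hv hv0 hv1 hδ0 hδ s
    -- Multiplication by the unit `I` turns the Stein difference into `φ' + tφ`.
    rw [← one_mul ‖_ - _‖, ← Complex.norm_I, ← norm_mul] at h1
    convert h1 using 2
    linear_combination (s * ∫ ω, Complex.exp ((s * (cubeTrace X ω / √6) : ℝ) * Complex.I) ∂μ)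
      * Complex.I_mul_I

end IsWignerArray

/-! ### From random networks to Wigner arrays on a finite cube -/

/-- Preimages under a zero variable are empty or everything, so it affects no product formula. This
adjoins the diagonal to the independent family of edges. -/
lemma ProbabilityTheory.iIndepFun.of_subtype_of_const {ι Ω : Type*} [MeasurableSpace Ω]
    {μ : Measure Ω} [IsProbabilityMeasure μ] {p : ι → Prop} {X : ι → Ω → ℝ}
    (hX : iIndepFun (fun i : {i // p i} => X i) μ) (h0 : ∀ i, ¬ p i → X i = 0) :
    iIndepFun X μ := by
  classical
  rw [iIndepFun_iff_measure_inter_preimage_eq_mul] at hX ⊢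
  intro S sets hsets
  by_cases hex : ∃ i ∈ S, ¬ p i ∧ (0 : ℝ) ∉ sets i
  · obtain ⟨i, hi, hpi, h0i⟩ := hex
    have h1 : X i ⁻¹' sets i = ∅ := by
      rw [h0 i hpi]; ext ω; simpa using h0i
    rw [Finset.prod_eq_zero hi (by rw [h1, measure_empty])]
    exact measure_mono_null (Set.biInter_subset_of_mem hi) (by rw [h1, measure_empty])
  · have h1 : ∀ i ∈ S, ¬ p i → X i ⁻¹' sets i = Set.univ := by
      intro i hi hpi
      have : (0 : ℝ) ∈ sets i := by
        by_contra hc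
        exact hex ⟨i, hi, hpi, hc⟩
      rw [h0 i hpi]; ext ω; simpa using this
    have h2 := hX (S.subtype p) (sets := fun i => sets i) fun i hi => hsets i (by simpa using hi)
    have h3 : ⋂ i ∈ S, X i ⁻¹' sets i
        = ⋂ i ∈ S.subtype p, X (i : {i // p i}) ⁻¹' sets i := by
      ext ω
      simp only [Set.mem_iInter, Finset.mem_subtype, Subtype.forall]
      refine ⟨fun h i _ hi => h i hi, fun h i hi => ?_⟩
      by_cases hpi : p i
      · exact h i hpi hi
      · rw [h1 i hi hpi]; trivial
    have h4 : ∏ i ∈ S, μ (X i ⁻¹' sets i)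
        = ∏ i ∈ S.subtype p, μ (X (i : {i // p i}) ⁻¹' sets i) := by
      rw [Finset.prod_subtype_eq_prod_filter (f := fun i => μ (X i ⁻¹' sets i)),
        Finset.prod_filter]
      refine Finset.prod_congr rfl fun i hi => ?_
      split_ifs with hpi
      · rfl
      · rw [h1 i hi hpi, measure_univ]
    rw [h3, h4]
    exact h2

lemma ProbabilityTheory.iIndepFun.map {ι Ω Ω' : Type*} [Fintype ι] [MeasurableSpace Ω]
    [MeasurableSpace Ω'] {μ : Measure Ω} [IsProbabilityMeasure μ] {B : Ω → Ω'} (hB : Measurable B)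
    {X : ι → Ω' → ℝ} (hXm : ∀ i, Measurable (X i)) (hX : iIndepFun (fun i ω => X i (B ω)) μ) :
    iIndepFun X (μ.map B) := by
  have := Measure.isProbabilityMeasure_map (μ := μ) hB.aemeasurable
  rw [iIndepFun_iff_map_fun_eq_pi_map fun i => (hXm i).aemeasurable,
    Measure.map_map (measurable_pi_lambda _ hXm) hB]
  simp_rw [Measure.map_map (hXm _) hB]
  exact (iIndepFun_iff_map_fun_eq_pi_map fun i => ((hXm i).comp hB).aemeasurable).1 hX

namespace IsRandomNetwork

variable {Ω : Type*} [MeasurableSpace Ω] {μ : Measure Ω} [IsProbabilityMeasure μ] {n : ℕ}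
  {A : Ω → Matrix (Fin n) (Fin n) ℝ}

lemma integrable_entry (hA : IsRandomNetwork μ A) (i j : Fin n) :
    Integrable (fun ω => A ω i j) μ :=
  Integrable.of_bound (hA.measurable_entry i j).aestronglyMeasurable 1 <|
    Eventually.of_forall fun ω => by
      rcases (hA.isAdjMatrix ω).zero_or_one i j with h | h <;> simp [h]

lemma linkProb_mem_Icc (hA : IsRandomNetwork μ A) (i j : Fin n) :
    linkProb μ A i j ∈ Set.Icc (0 : ℝ) 1 := by
  constructor
  · refine integral_nonneg fun ω => ?_
    rcases (hA.isAdjMatrix ω).zero_or_one i j with h | h <;> simp [h]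
  · have : ∫ ω, A ω i j ∂μ ≤ ∫ _, (1 : ℝ) ∂μ := by
      refine integral_mono (hA.integrable_entry i j) (integrable_const _) fun ω => ?_
      rcases (hA.isAdjMatrix ω).zero_or_one i j with h | h <;> simp [h]
    simpa [linkProb] using this

lemma integral_entry_sub_sq (hA : IsRandomNetwork μ A) (i j : Fin n) :
    ∫ ω, (A ω i j - linkProb μ A i j) ^ 2 ∂μ
      = linkProb μ A i j * (1 - linkProb μ A i j) := by
  -- As `A_ij` is `0` or `1`, it equals its square, so the expression is affine in it.
  have h1 : ∀ ω, (A ω i j - linkProb μ A i j) ^ 2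
      = (1 - 2 * linkProb μ A i j) * A ω i j + linkProb μ A i j ^ 2 := by
    intro ω
    rcases (hA.isAdjMatrix ω).zero_or_one i j with h | h <;> rw [h] <;> ring
  simp_rw [h1]
  rw [integral_add ((hA.integrable_entry i j).const_mul _) (integrable_const _),
    integral_const_mul]
  simp only [integral_const, probReal_univ, smul_eq_mul, one_mul]
  rw [← linkProb]
  ring

lemma linkProb_comm (hA : IsRandomNetwork μ A) (i j : Fin n) :
    linkProb μ A i j = linkProb μ A j i := by
  simp only [linkProb]
  exact integral_congr_ae (Eventually.of_forall fun ω => (hA.isAdjMatrix ω).symm.apply j i)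

lemma oracleNormalized_comm (hA : IsRandomNetwork μ A) (ω : Ω) (i j : Fin n) :
    oracleNormalized μ A ω i j = oracleNormalized μ A ω j i := by
  simp only [oracleNormalized, Matrix.of_apply, hA.linkProb_comm i j,
    (hA.isAdjMatrix ω).symm.apply j i, eq_comm (a := i)]

lemma measurable_oracleNormalized (hA : IsRandomNetwork μ A) (i j : Fin n) :
    Measurable fun ω => oracleNormalized μ A ω i j := by
  simp only [oracleNormalized, Matrix.of_apply]
  split_ifs
  · exact measurable_const
  · exact ((hA.measurable_entry i j).sub_const _).div_const _

lemma measurable_trace_oracleNormalized_pow_three (hA : IsRandomNetwork μ A) :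
    Measurable fun ω => Matrix.trace (oracleNormalized μ A ω ^ 3) := by
  have := hA.measurable_oracleNormalized
  simp only [Matrix.trace, Matrix.diag, pow_three, Matrix.mul_apply]
  fun_prop

/-- The indicator vector of the edges of the network. -/
noncomputable def edgeIndicator (A : Ω → Matrix (Fin n) (Fin n) ℝ) (ω : Ω) (e : Sym2 (Fin n)) :
    Bool := by
  classical exact decide (A ω e.inf e.sup = 1)

/-- The entries of the oracle normalized adjacency matrix as functions of the indicator vector
of the edges. -/
noncomputable def normalizedEdge (μ : Measure Ω) (A : Ω → Matrix (Fin n) (Fin n) ℝ)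
    (e : Sym2 (Fin n)) (b : Sym2 (Fin n) → Bool) : ℝ :=
  if e.inf = e.sup then 0
  else ((if b e then 1 else 0) - linkProb μ A e.inf e.sup) /
    √((n : ℝ) * linkProb μ A e.inf e.sup * (1 - linkProb μ A e.inf e.sup))

lemma measurable_edgeIndicator (hA : IsRandomNetwork μ A) : Measurable (edgeIndicator A) := by
  refine measurable_pi_lambda _ fun e => measurable_to_bool ?_
  have : (fun ω => edgeIndicator A ω e) ⁻¹' {true} = (fun ω => A ω e.inf e.sup) ⁻¹' {1} := by
    ext ω; simp [edgeIndicator]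
  rw [this]
  exact hA.measurable_entry _ _ (measurableSet_singleton 1)

lemma normalizedEdge_edgeIndicator (hA : IsRandomNetwork μ A) (e : Sym2 (Fin n)) (ω : Ω) :
    normalizedEdge μ A e (edgeIndicator A ω) = oracleNormalized μ A ω e.inf e.sup := by
  simp only [normalizedEdge, oracleNormalized, Matrix.of_apply, edgeIndicator]
  congr 3
  rcases (hA.isAdjMatrix ω).zero_or_one e.inf e.sup with h | h <;> simp [h]

lemma inf_eq_sup_iff {e : Sym2 (Fin n)} : e.inf = e.sup ↔ e.IsDiag := by
  induction e with
  | h i j => simp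

lemma cubeTrace_normalizedEdge (hA : IsRandomNetwork μ A) (ω : Ω) :
    cubeTrace (normalizedEdge μ A) (edgeIndicator A ω)
      = Matrix.trace (oracleNormalized μ A ω ^ 3) := by
  rw [cubeTrace]
  congr 2
  ext i j
  rw [Matrix.of_apply, hA.normalizedEdge_edgeIndicator]
  rcases le_total i j with h | h
  · simp [h]
  · simp only [Sym2.inf_mk, Sym2.sup_mk, inf_of_le_right h, sup_of_le_left h]
    exact hA.oracleNormalized_comm ω j i

lemma iIndepFun_oracleNormalized (hA : IsRandomNetwork μ A) :
    iIndepFun (fun (e : Sym2 (Fin n)) ω => oracleNormalized μ A ω e.inf e.sup) μ := by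
  refine iIndepFun.of_subtype_of_const (p := fun e => ¬ e.IsDiag) ?_ ?_
  · have hlt : ∀ e : {e : Sym2 (Fin n) // ¬ e.IsDiag}, e.1.inf < e.1.sup := fun e =>
      lt_of_le_of_ne (Sym2.inf_le_sup _) fun h => e.2 (inf_eq_sup_iff.1 h)
    have h1 := hA.indep.precomp
      (g := fun e : {e : Sym2 (Fin n) // ¬ e.IsDiag} => ⟨(e.1.inf, e.1.sup), hlt e⟩) (by
        intro e f hef
        simp only [Subtype.mk.injEq, Prod.mk.injEq] at hef
        exact Subtype.ext (Sym2.inf_eq_inf_and_sup_eq_sup.1 hef))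
    have h2 := h1.comp (fun e x => (x - linkProb μ A e.1.inf e.1.sup) /
      √((n : ℝ) * linkProb μ A e.1.inf e.1.sup * (1 - linkProb μ A e.1.inf e.1.sup)))
      (fun e => by fun_prop)
    convert h2 using 1
    funext e ω
    simp only [oracleNormalized, Matrix.of_apply, if_neg (hlt e).ne, Function.comp_apply]
  · intro e he
    rw [not_not, ← inf_eq_sup_iff] at he
    funext ω
    simp [oracleNormalized, he]

/-- Normalization makes every off-diagonal variance exactly `1/n`, whatever the link probabilities.
The bound `1/√C` comes from `|A_ij - p_ij| ≤ 1` and a denominator of at least `√C`. -/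
lemma isWignerArray (hA : IsRandomNetwork μ A) {C : ℝ} (hC : 0 < C)
    (hp : ∀ i j, i ≠ j → C ≤ n * (linkProb μ A i j * (1 - linkProb μ A i j))) :
    IsWignerArray (normalizedEdge μ A) (μ.map (edgeIndicator A)) (1 / n) (1 / √C) where
  indep := by
    refine iIndepFun.map hA.measurable_edgeIndicator (fun _ => .of_discrete) ?_
    simp_rw [hA.normalizedEdge_edgeIndicator]
    exact hA.iIndepFun_oracleNormalized
  diag e he := by
    funext b
    simp [normalizedEdge, inf_eq_sup_iff.2 he]
  mean e he := by
    rw [integral_map hA.measurable_edgeIndicator.aemeasurable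
      (Measurable.of_discrete).aestronglyMeasurable]
    simp_rw [hA.normalizedEdge_edgeIndicator]
    simp only [oracleNormalized, Matrix.of_apply, if_neg (mt inf_eq_sup_iff.1 he)]
    rw [integral_div, integral_sub (hA.integrable_entry _ _) (integrable_const _)]
    simp [linkProb]
  var e he := by
    rw [integral_map hA.measurable_edgeIndicator.aemeasurable
      (Measurable.of_discrete).aestronglyMeasurable]
    simp_rw [hA.normalizedEdge_edgeIndicator]
    have hne := mt inf_eq_sup_iff.1 he
    have h1 := hC.trans_le (hp _ _ hne)
    simp only [oracleNormalized, Matrix.of_apply, if_neg hne, div_pow]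
    rw [integral_div, hA.integral_entry_sub_sq, Real.sq_sqrt (by rw [mul_assoc]; exact h1.le)]
    have h2 : linkProb μ A e.inf e.sup * (1 - linkProb μ A e.inf e.sup) ≠ 0 := by
      intro h; rw [h, mul_zero] at h1; exact lt_irrefl _ h1
    rw [mul_assoc, div_mul_cancel_right₀ h2, one_div]
  bound e b := by
    rw [normalizedEdge]
    split_ifs with he hb
    · simp
    all_goals
      have h1 := hp _ _ he
      obtain ⟨h2, h3⟩ := hA.linkProb_mem_Icc e.inf e.sup
      rw [abs_div, abs_of_nonneg (Real.sqrt_nonneg _), mul_assoc]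
      gcongr
      rw [abs_le]
      constructor <;> linarith

lemma norm_integral_exp_mul_exp_sub_one_le (hA : IsRandomNetwork μ A) (hn : 0 < n) {C : ℝ}
    (hC : 1 ≤ C) (hp : ∀ i j, i ≠ j → C ≤ n * (linkProb μ A i j * (1 - linkProb μ A i j)))
    (t : ℝ) :
    ‖(∫ ω, Complex.exp ((t * (Matrix.trace (oracleNormalized μ A ω ^ 3) / √6) : ℝ)
          * Complex.I) ∂μ) * Complex.exp ((t ^ 2 / 2 : ℝ)) - 1‖
      ≤ (126 * (1 / √C) * t ^ 2 + ((2 * (1 / √C) ^ 2 + 2 * (1 / n))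
          + 2 * √((1 / √C) ^ 2 + 2 * (1 / n)) + 2 * √(1 / n)) * |t|)
        * Real.exp (t ^ 2 / 2) * |t| := by
  have := Measure.isProbabilityMeasure_map (μ := μ) hA.measurable_edgeIndicator.aemeasurable
  have hn1 : (1 : ℝ) ≤ n := by exact_mod_cast hn
  have h := (hA.isWignerArray (by linarith) hp).norm_integral_exp_mul_exp_sub_one_le
    (by rw [Fintype.card_fin]; field_simp) (by positivity)
    (by rw [div_le_one (by positivity)]; exact hn1) (by positivity)
    (by
      rw [div_pow, Real.sq_sqrt (by linarith), one_pow, div_le_one (by linarith)]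
      exact hC) t
  rw [integral_map hA.measurable_edgeIndicator.aemeasurable
    (Measurable.of_discrete).aestronglyMeasurable] at h
  simp_rw [hA.cubeTrace_normalizedEdge] at h
  exact h

end IsRandomNetwork

/-! ### Lévy's continuity theorem and the limit -/

theorem lemma1 {Ω : ℕ → Type*} [∀ n, MeasurableSpace (Ω n)]
    (μ : (n : ℕ) → Measure (Ω n)) [∀ n, IsProbabilityMeasure (μ n)]
    (A : (n : ℕ) → Ω n → Matrix (Fin n) (Fin n) ℝ)
    (hA : ∀ n, IsRandomNetwork (μ n) (A n))
    (hp : ∀ C : ℝ, ∀ᶠ n : ℕ in atTop, ∀ i j : Fin n, i ≠ j →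
      C ≤ (n : ℝ) * (linkProb (μ n) (A n) i j * (1 - linkProb (μ n) (A n) i j))) :
    TendstoInDistribution
      (fun n ω => Matrix.trace (oracleNormalized (μ n) (A n) ω ^ 3) / Real.sqrt 6)
      atTop (id : ℝ → ℝ) μ (gaussianReal 0 1) := by
  have hmeas : ∀ n, AEMeasurable
      (fun ω => Matrix.trace (oracleNormalized (μ n) (A n) ω ^ 3) / √6) (μ n) := fun n =>
    ((hA n).measurable_trace_oracleNormalized_pow_three.div_const _).aemeasurable
  refine ⟨hmeas, by fun_prop, ?_⟩
  refine ProbabilityMeasure.tendsto_iff_tendsto_charFun.2 fun t => ?_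
  simp only [ProbabilityMeasure.coe_mk, Measure.map_id, charFun_gaussianReal]
  set φ : ℕ → ℂ := fun n => ∫ ω, Complex.exp
    ((t * (Matrix.trace (oracleNormalized (μ n) (A n) ω ^ 3) / √6) : ℝ) * Complex.I) ∂(μ n) with hφ
  have hchar : ∀ n, charFun ((μ n).map
      fun ω => Matrix.trace (oracleNormalized (μ n) (A n) ω ^ 3) / √6) t = φ n := by
    intro n
    rw [charFun_apply_real, integral_map (hmeas n) (by fun_prop), hφ]
    congr 1 with ω
    push_cast
    rfl
  simp_rw [hchar]
  -- The variance bound `C` and the size `n` are treated as independent variables `q = (C, n)`,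
  -- since no rate of divergence is given.
  have hbound : Tendsto (fun q : ℝ × ℕ =>
      (126 * (1 / √q.1) * t ^ 2 + ((2 * (1 / √q.1) ^ 2 + 2 * (1 / (q.2 : ℝ)))
          + 2 * √((1 / √q.1) ^ 2 + 2 * (1 / (q.2 : ℝ))) + 2 * √(1 / (q.2 : ℝ))) * |t|)
        * Real.exp (t ^ 2 / 2) * |t|) (atTop ×ˢ atTop) (nhds 0) := by
    have h1 : Tendsto (fun q : ℝ × ℕ => 1 / √q.1) (atTop ×ˢ atTop) (nhds 0) := by
      simp_rw [one_div]
      exact tendsto_inv_atTop_zero.comp (Real.tendsto_sqrt_atTop.comp tendsto_fst)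
    have h2 : Tendsto (fun q : ℝ × ℕ => 1 / (q.2 : ℝ)) (atTop ×ˢ atTop) (nhds 0) :=
      tendsto_one_div_atTop_nhds_zero_nat.comp tendsto_snd
    have h3 : Continuous fun p : ℝ × ℝ =>
        (126 * p.1 * t ^ 2 + ((2 * p.1 ^ 2 + 2 * p.2)
          + 2 * √(p.1 ^ 2 + 2 * p.2) + 2 * √p.2) * |t|) * Real.exp (t ^ 2 / 2) * |t| := by
      fun_prop
    have h4 := (h3.tendsto (0, 0)).comp (h1.prodMk_nhds h2)
    simpa [Function.comp_def] using h4
  have hlim : Tendsto (fun n => φ n * Complex.exp ((t ^ 2 / 2 : ℝ))) atTop (nhds 1) := by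
    rw [Metric.tendsto_nhds]
    intro ε hε
    -- Currying fixes one `C ≥ 1` for which the error is below `ε` for all large `n`; only then is
    -- `hp` applied, at this `C`.
    obtain ⟨C, hC, hC1⟩ :=
      ((hbound.eventually_lt_const hε).curry.and (eventually_ge_atTop 1)).exists
    filter_upwards [hC, hp C, eventually_gt_atTop 0] with n h1 h2 h3
    rw [dist_eq_norm]
    exact ((hA n).norm_integral_exp_mul_exp_sub_one_le h3 hC1 h2 t).trans_lt h1
  have h5 := hlim.mul_const (Complex.exp (-(t ^ 2 / 2 : ℝ)))
  refine (h5.congr fun n => ?_).trans (le_of_eq ?_)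
  · rw [mul_assoc, ← Complex.exp_add]; simp
  · congr 1; push_cast; rw [one_mul]; congr 1; simp
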